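/- Let $n\ge 3$ be an integer and let $\mu>0$, $\nu>0$ be constants. Let $K_{\alpha}$ denote the modified Bessel function of the second kind, $K_\alpha(z)=\int_0^\infty e^{-z\cosh t}\cosh(\alpha t)\,dt$ for $z>0$, and set $$\mathcal{G}_{\mu,\nu}(x)=(2\pi\mu)^{-n/2}\left(\frac{\sqrt{\nu\mu}}{|x|}\right)^{n/2-1}K_{n/2-1}\!\left(\frac{\sqrt{\nu}\,|x|}{\sqrt{\mu}}\right),\qquad x\in\mathbb{R}^n\setminus\{0\}.$$ Call a real function $G$ of $(x,\xi)\in\mathbb{R}^n\times\mathbb{R}^n$ a fundamental solution of $-\mu\Delta+\nu$ if $G(\cdot,\xi)\in C(\mathbb{R}^n\setminus\{\xi\})$ for every $\xi$, $G(x,\cdot)\in C(\mathbb{R}^n\setminus\{x\})$ for every $x$, and (i) $(-\mu\Delta+\nu)G(\cdot,\xi)=0$ in $\mathscr{D}'(\mathbb{R}^n\setminus\{\xi\})$ for every $\xi\in\mathbb{R}^n$; (ii) for every $f\in C_0^\infty(\mathbb{R}^n)$ and every $x\in\mathbb{R}^n$ the integral $u(x)=\int_{\mathbb{R}^n}G(x,\xi)f(\xi)\,d\xi$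 converges absolutely, $u$ belongs to $H^2(\mathbb{R}^n)$, and $u$ is the unique (up to equality almost everywhere) solution in $H^2(\mathbb{R}^n)$ of $-\mu\Delta u+\nu u=f$. Then $G_{\mu,\nu}(x,\xi)=\mathcal{G}_{\mu,\nu}(x-\xi)$ is a fundamental solution of $-\mu\Delta+\nu$, and it is the only one: every fundamental solution $G$ satisfies $G(x,\xi)=\mathcal{G}_{\mu,\nu}(x-\xi)$ for all $x\ne\xi$. Moreover there is a constant $C=C(n,\mu,\nu)>1$ such that $$C^{-1}\,\frac{e^{-\sqrt{\nu}|x|/\sqrt{\mu}}}{|x|^{n-2}}\le \mathcal{G}_{\mu,\nu}(x)\le C\,\frac{e^{-\sqrt{\nu}|x|/(2\sqrt{\mu})}}{|x|^{n-2}},\qquad x\in\mathbb{R}^n\setminus\{0\}.$$ -/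

import Mathlib

noncomputable section

open MeasureTheory
open scoped SchwartzMap ContDiff Laplacian

/-- The modified Bessel function of the second kind of real order `α`, for a real argument `z > 0`:
`K_α(z) = ∫_0^∞ exp (-z cosh t) cosh (α t) dt`. -/
def besselK (α z : ℝ) : ℝ :=
  ∫ t in Set.Ioi (0 : ℝ), Real.exp (-z * Real.cosh t) * Real.cosh (α * t)

/-- The kernel
`𝒢_{μ,ν}(x) = (2πμ)^{-n/2} (√(νμ) / |x|)^{n/2-1} K_{n/2-1}(√ν |x| / √μ)` on `ℝⁿ`, for `x ≠ 0`. -/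
def greenKernel (n : ℕ) (μ ν : ℝ) (x : EuclideanSpace ℝ (Fin n)) : ℝ :=
  (2 * Real.pi * μ) ^ (-(n : ℝ) / 2) * (Real.sqrt (ν * μ) / ‖x‖) ^ ((n : ℝ) / 2 - 1)
    * besselK ((n : ℝ) / 2 - 1) (Real.sqrt ν * ‖x‖ / Real.sqrt μ)

/-- Test functions: `φ ∈ C_0^∞(ℝⁿ)`, real valued. -/
def IsTestFunction {n : ℕ} (φ : EuclideanSpace ℝ (Fin n) → ℝ) : Prop :=
  ContDiff ℝ ∞ φ ∧ HasCompactSupport φ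

/-- The real function `u` (up to equality almost everywhere) belongs to the Sobolev space `H²(ℝⁿ)`
and satisfies `-μ Δ u + ν u = f`, where `Δ u` is the distributional Laplacian of `u` and the
equation is tested against all Schwartz functions. -/
def IsH2Solution {n : ℕ} (μ ν : ℝ) (f u : EuclideanSpace ℝ (Fin n) → ℝ) : Prop :=
  ∃ hu : MemLp (fun x => (u x : ℂ)) 2 (volume : Measure (EuclideanSpace ℝ (Fin n))),
    TemperedDistribution.MemSobolev 2 2 (hu.toLp : 𝓢'(EuclideanSpace ℝ (Fin n), ℂ)) ∧
    ∀ φ : 𝓢(EuclideanSpace ℝ (Fin n), ℂ),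
      (-(μ : ℂ) • Δ (hu.toLp : 𝓢'(EuclideanSpace ℝ (Fin n), ℂ))
        + (ν : ℂ) • (hu.toLp : 𝓢'(EuclideanSpace ℝ (Fin n), ℂ))) φ = ∫ x, φ x * (f x : ℂ)

/-- `G` is a fundamental solution of the operator `-μ Δ + ν` on `ℝⁿ`.
The values of `G` on the diagonal play no role. -/
structure IsFundamentalSolution {n : ℕ} (μ ν : ℝ)
    (G : EuclideanSpace ℝ (Fin n) → EuclideanSpace ℝ (Fin n) → ℝ) : Prop where
  /-- `G(·, ξ)` is continuous on `ℝⁿ ∖ {ξ}`. -/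
  continuousOn_left : ∀ ξ, ContinuousOn (fun x => G x ξ) {ξ}ᶜ
  /-- `G(x, ·)` is continuous on `ℝⁿ ∖ {x}`. -/
  continuousOn_right : ∀ x, ContinuousOn (fun ξ => G x ξ) {x}ᶜ
  /-- `(-μ Δ + ν) G(·, ξ) = 0` in the sense of distributions on `ℝⁿ ∖ {ξ}`. -/
  distrib_eq_zero : ∀ ξ, ∀ φ : EuclideanSpace ℝ (Fin n) → ℝ, IsTestFunction φ → ξ ∉ tsupport φ →
    ∫ x, G x ξ * (-μ * (Δ φ) x + ν * φ x) = 0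
  /-- The potential `∫ G(x, ξ) f(ξ) dξ` of a test function converges for every `x`. -/
  integrable : ∀ f : EuclideanSpace ℝ (Fin n) → ℝ, IsTestFunction f → ∀ x,
    Integrable (fun ξ => G x ξ * f ξ)
  /-- The potential of a test function `f` lies in `H²(ℝⁿ)` and solves `-μ Δ u + ν u = f`. -/
  isH2Solution : ∀ f : EuclideanSpace ℝ (Fin n) → ℝ, IsTestFunction f →
    IsH2Solution μ ν f (fun x => ∫ ξ, G x ξ * f ξ)
  /-- It is the unique solution in `H²(ℝⁿ)`. -/
  unique_solution : ∀ f : EuclideanSpace ℝ (Fin n) → ℝ, IsTestFunction f →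
    ∀ v : EuclideanSpace ℝ (Fin n) → ℝ, IsH2Solution μ ν f v →
      v =ᵐ[volume] fun x => ∫ ξ, G x ξ * f ξ

end

/-!
Write `m(ξ) = 4π²μ|ξ|² + ν` for the symbol of `-μ Δ + ν`.

The substitution `t = |x| / (2 √(νμ)) * exp s` in the Bessel integral shows that the Green kernel is
the Laplace transform of the heat kernel,
`𝒢(x) = ∫_0^∞ exp (-ν t) (4πμt)^{-n/2} exp (-|x|² / (4μt)) dt`
(`greenKernel_eq_integral_dampedHeatKernel`). The integrand is integrable in `(t, x)` jointly, so
`𝒢` is integrable and, by Fubini, its Fourier transform is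
`∫_0^∞ exp (-m(ξ) t) dt = 1 / m(ξ)` (`fourier_greenKernel`). Hence convolution with `𝒢` inverts
`-μ Δ + ν` on Schwartz functions (`integral_greenKernel_mul_schwartzHelmholtz`).

Since `m` and `1 / m` are of temperate growth, `-μ Δ + ν` is also onto the Schwartz space. So the
potential of a test function is a Schwartz function solving the equation, and two solutions in `H²`
agree, as their difference annihilates the range of `-μ Δ + ν` (`IsH2Solution.ae_eq`). The equation
away from the pole is the inversion identity read off at a point outside the support of the test
function.

For uniqueness, the potentials with respect to two fundamental solutions agree almost everywhere,
with an exceptional set that depends on the test function. Countably many bumps have a common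
exceptional set and suffice to compare the two continuous functions of `ξ`; continuity in `x`
removes the exceptional set (`IsFundamentalSolution.eq`).

The two-sided bound comes from `K_α(z) ≤ C z^{-α} exp (-z / 2)`, where half of the exponent
`z cosh t` is traded for convergence (`besselK_le`), and `K_α(z) ≥ c z^{-α} exp (-z)`, where
`u = 2 sinh (t / 2)` turns the integral into a Gaussian moment (`le_besselK`). The latter uses
`α = n / 2 - 1 ≥ 1 / 2`.
-/

noncomputable section

open MeasureTheory FourierTransform
open scoped SchwartzMap ContDiff Laplacian

/-! ### The modified Bessel function of the second kind -/

lemma sq_div_four_le_cosh (s : ℝ) : s ^ 2 / 4 ≤ Real.cosh s := by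
  have h := Real.quadratic_le_exp_of_nonneg (abs_nonneg s)
  rw [← Real.cosh_abs, Real.cosh_eq, ← sq_abs]
  nlinarith [Real.exp_pos (-|s|), abs_nonneg s]

lemma exp_neg_mul_cosh_le {z : ℝ} (hz : 0 < z) (α s : ℝ) :
    Real.exp (-z * Real.cosh s) * Real.exp (α * s)
      ≤ Real.exp (2 * α ^ 2 / z) * Real.exp (-(z / 8) * s ^ 2) := by
  rw [← Real.exp_add, ← Real.exp_add, Real.exp_le_exp]
  have h1 : z * (s ^ 2 / 4) ≤ z * Real.cosh s :=
    mul_le_mul_of_nonneg_left (sq_div_four_le_cosh s) hz.le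
  have h2 : 0 ≤ (z * s - 4 * α) ^ 2 / (8 * z) := by positivity
  have h3 : (z * s - 4 * α) ^ 2 / (8 * z) = z / 8 * s ^ 2 - α * s + 2 * α ^ 2 / z := by
    field_simp; ring
  linarith

lemma integrable_exp_neg_mul_cosh_mul_exp {z : ℝ} (hz : 0 < z) (α : ℝ) :
    Integrable fun s : ℝ => Real.exp (-z * Real.cosh s) * Real.exp (α * s) := by
  refine ((integrable_exp_neg_mul_sq (by positivity : 0 < z / 8)).const_mul
    (Real.exp (2 * α ^ 2 / z))).mono' (by fun_prop) (ae_of_all _ fun s => ?_)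
  rw [Real.norm_of_nonneg (by positivity)]
  exact exp_neg_mul_cosh_le hz α s

lemma integrable_exp_neg_mul_cosh_mul_cosh {z : ℝ} (hz : 0 < z) (α : ℝ) :
    Integrable fun s : ℝ => Real.exp (-z * Real.cosh s) * Real.cosh (α * s) := by
  refine (((integrable_exp_neg_mul_cosh_mul_exp hz α).add
    (integrable_exp_neg_mul_cosh_mul_exp hz (-α))).const_mul (1 / 2)).congr
    (ae_of_all _ fun s => ?_)
  simp only [Pi.add_apply, Real.cosh_eq (α * s), neg_mul]
  ring

lemma continuousOn_besselK (α : ℝ) : ContinuousOn (besselK α) (Set.Ioi 0) := by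
  intro z₀ hz₀
  rw [Set.mem_Ioi] at hz₀
  refine ContinuousAt.continuousWithinAt ?_
  refine continuousAt_of_dominated (bound := fun s =>
    Real.exp (-(z₀ / 2) * Real.cosh s) * Real.cosh (α * s)) ?_ ?_ ?_ ?_
  · exact Filter.Eventually.of_forall fun z => by fun_prop
  · filter_upwards [lt_mem_nhds (half_lt_self hz₀)] with z hz
    refine ae_of_all _ fun s => ?_
    rw [Real.norm_of_nonneg (by positivity)]
    gcongr
  · exact (integrable_exp_neg_mul_cosh_mul_cosh (half_pos hz₀) α).integrableOn
  · exact ae_of_all _ fun s => by fun_prop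

/-- The integral over `(0, ∞)` unfolds to the whole line, since `cosh` is even. -/
lemma besselK_eq_integral_real {z : ℝ} (hz : 0 < z) (α : ℝ) :
    besselK α z = 1 / 2 * ∫ s : ℝ, Real.exp (-z * Real.cosh s) * Real.exp (-α * s) := by
  have h1 := integrable_exp_neg_mul_cosh_mul_exp hz (-α)
  have h2 := integrable_exp_neg_mul_cosh_mul_exp hz α
  have e : ∫ s in Set.Iic (0 : ℝ), Real.exp (-z * Real.cosh s) * Real.exp (-α * s)
      = ∫ s in Set.Ioi (0 : ℝ), Real.exp (-z * Real.cosh s) * Real.exp (α * s) := by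
    have := integral_comp_neg_Iic (0 : ℝ)
      (fun s => Real.exp (-z * Real.cosh s) * Real.exp (α * s))
    simpa using this
  rw [← intervalIntegral.integral_Iic_add_Ioi (b := 0) h1.integrableOn h1.integrableOn, e,
    ← integral_add h2.integrableOn h1.integrableOn, ← integral_const_mul, besselK]
  refine setIntegral_congr_fun measurableSet_Ioi fun s _ => ?_
  simp only [Real.cosh_eq (α * s), neg_mul]
  ring

/-- The substitution `t = a * exp s` maps the line onto `(0, ∞)`. -/
lemma image_const_mul_exp {a : ℝ} (ha : 0 < a) :
    (fun s : ℝ => a * Real.exp s) '' Set.univ = Set.Ioi 0 := by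
  ext t
  simp only [Set.image_univ, Set.mem_range, Set.mem_Ioi]
  constructor
  · rintro ⟨s, rfl⟩; positivity
  · intro ht
    exact ⟨Real.log (t / a), by rw [Real.exp_log (by positivity)]; field_simp⟩

lemma injective_const_mul_exp {a : ℝ} (ha : 0 < a) :
    Function.Injective fun s : ℝ => a * Real.exp s := fun _ _ h =>
  Real.exp_injective (mul_left_cancel₀ ha.ne' h)

lemma integral_Ioi_eq_integral_const_mul_exp {a : ℝ} (ha : 0 < a) (h : ℝ → ℝ) :
    ∫ t in Set.Ioi 0, h t = ∫ s : ℝ, a * Real.exp s * h (a * Real.exp s) := by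
  rw [← image_const_mul_exp ha, integral_image_eq_integral_abs_deriv_smul MeasurableSet.univ
    (fun s _ => ((Real.hasDerivAt_exp s).const_mul a).hasDerivWithinAt)
    (injective_const_mul_exp ha).injOn, setIntegral_univ]
  congr with s
  rw [abs_of_pos (by positivity), smul_eq_mul]

lemma integrableOn_Ioi_iff_integrable_const_mul_exp {a : ℝ} (ha : 0 < a) (h : ℝ → ℝ) :
    IntegrableOn h (Set.Ioi 0) ↔ Integrable fun s : ℝ => a * Real.exp s * h (a * Real.exp s) := by
  rw [← image_const_mul_exp ha, integrableOn_image_iff_integrableOn_abs_deriv_smul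
    MeasurableSet.univ (fun s _ => ((Real.hasDerivAt_exp s).const_mul a).hasDerivWithinAt)
    (injective_const_mul_exp ha).injOn, integrableOn_univ]
  refine integrable_congr (ae_of_all _ fun s => ?_)
  simp only [abs_of_pos (by positivity : 0 < a * Real.exp s), smul_eq_mul]

/-- `K_α(z) ≤ Γ(α) (4 / z) ^ α exp (-z / 2)`. -/
lemma besselK_le {α z : ℝ} (hα : 0 < α) (hz : 0 < z) :
    besselK α z ≤ Real.Gamma α * (4 / z) ^ α * Real.exp (-(z / 2)) := by
  have hz4 : 0 < z / 4 := by positivity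
  have hint : IntegrableOn (fun t : ℝ => t ^ (α - 1) * Real.exp (-(z / 4 * t))) (Set.Ioi 0) := by
    have := integrableOn_rpow_mul_exp_neg_mul_rpow (p := 1) (s := α - 1) (by linarith) one_pos hz4
    simpa using this
  have hsub : ∀ s : ℝ, 1 * Real.exp s * ((1 * Real.exp s) ^ (α - 1) *
      Real.exp (-(z / 4 * (1 * Real.exp s)))) =
      Real.exp (-(z / 4 * Real.exp s)) * Real.exp (α * s) := by
    intro s
    rw [one_mul, ← Real.exp_mul, ← mul_assoc, ← Real.exp_add, mul_comm]
    congr 2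
    ring
  have hint' : Integrable fun s : ℝ => Real.exp (-(z / 4 * Real.exp s)) * Real.exp (α * s) := by
    rw [integrableOn_Ioi_iff_integrable_const_mul_exp one_pos] at hint
    simpa only [hsub] using hint
  have hval : ∫ s : ℝ, Real.exp (-(z / 4 * Real.exp s)) * Real.exp (α * s)
      = (4 / z) ^ α * Real.Gamma α := by
    rw [← integral_congr_ae (ae_of_all _ hsub), ← integral_Ioi_eq_integral_const_mul_exp one_pos
      (fun t => t ^ (α - 1) * Real.exp (-(z / 4 * t))),
      Real.integral_rpow_mul_exp_neg_mul_Ioi hα hz4, one_div_div]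
  calc besselK α z
      ≤ ∫ s in Set.Ioi 0, Real.exp (-(z / 2)) *
          (Real.exp (-(z / 4 * Real.exp s)) * Real.exp (α * s)) := by
        refine setIntegral_mono_on (integrable_exp_neg_mul_cosh_mul_cosh hz α).integrableOn
          (hint'.const_mul _).integrableOn measurableSet_Ioi fun s hs => ?_
        rw [Set.mem_Ioi] at hs
        rw [← mul_assoc, ← Real.exp_add]
        gcongr
        -- Half of `z cosh s` is bounded by `1 ≤ cosh s`, the other half by `exp s / 2 ≤ cosh s`.
        · have h1 := Real.one_le_cosh s
          have h2 : Real.exp s / 2 ≤ Real.cosh s := by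
            rw [Real.cosh_eq]; linarith [Real.exp_pos (-s)]
          nlinarith
        · rw [Real.cosh_eq]
          have : Real.exp (-(α * s)) ≤ Real.exp (α * s) := by
            gcongr; nlinarith [mul_pos hα hs]
          linarith
    _ ≤ ∫ s : ℝ, Real.exp (-(z / 2)) *
          (Real.exp (-(z / 4 * Real.exp s)) * Real.exp (α * s)) :=
        setIntegral_le_integral (hint'.const_mul _) (ae_of_all _ fun s => by positivity)
    _ = _ := by rw [integral_const_mul, hval]; ring

lemma image_two_mul_sinh_half : (fun t : ℝ => 2 * Real.sinh (t / 2)) '' Set.Ioi 0 = Set.Ioi 0 := by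
  ext u
  simp only [Set.mem_image, Set.mem_Ioi]
  constructor
  · rintro ⟨t, ht, rfl⟩
    have := Real.sinh_pos_iff.2 (half_pos ht)
    positivity
  · intro hu
    refine ⟨2 * Real.arsinh (u / 2), ?_, ?_⟩
    · have := Real.arsinh_pos_iff.2 (half_pos hu)
      positivity
    · rw [mul_div_cancel_left₀ _ two_ne_zero, Real.sinh_arsinh]; ring

/-- The substitution `u = 2 sinh (t / 2)`, for which `cosh t = 1 + u ^ 2 / 2`, turns the Bessel
integrand into a Gaussian; it gives the lower bound `K_α(z) ≥ c z ^ (-α) exp (-z)`. -/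
lemma le_besselK {α z : ℝ} (hα : 1 / 2 ≤ α) (hz : 0 < z) :
    (2 : ℝ) ^ (-2 * α) * (1 / 2) * Real.Gamma α * (2 / z) ^ α * Real.exp (-z) ≤ besselK α z := by
  have hz2 : 0 < z / 2 := by positivity
  have hderiv : ∀ t ∈ Set.Ioi (0 : ℝ), HasDerivWithinAt (fun t : ℝ => 2 * Real.sinh (t / 2))
      (Real.cosh (t / 2)) (Set.Ioi 0) t := fun t _ => by
    refine (((hasDerivAt_id t).div_const 2).sinh.const_mul 2).hasDerivWithinAt.congr_deriv ?_
    simp only [id_eq]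
    ring
  have hinj : Set.InjOn (fun t : ℝ => 2 * Real.sinh (t / 2)) (Set.Ioi 0) := fun s _ t _ h => by
    have := Real.sinh_injective (mul_left_cancel₀ two_ne_zero h)
    linarith
  have hint : IntegrableOn (fun u : ℝ => u ^ (2 * α - 1) * Real.exp (-(z / 2) * u ^ (2 : ℝ)))
      (Set.Ioi 0) :=
    integrableOn_rpow_mul_exp_neg_mul_rpow (by linarith) two_pos hz2
  have hval : ∫ u in Set.Ioi (0 : ℝ), u ^ (2 * α - 1) * Real.exp (-(z / 2) * u ^ (2 : ℝ))
      = (2 / z) ^ α * (1 / 2) * Real.Gamma α := by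
    rw [integral_rpow_mul_exp_neg_mul_rpow two_pos (by linarith) hz2]
    rw [show (2 * α - 1 + 1) / 2 = α by ring, show -(2 * α - 1 + 1) / 2 = -α by ring,
      Real.rpow_neg hz2.le, ← Real.inv_rpow hz2.le, inv_div]
  rw [← image_two_mul_sinh_half, integrableOn_image_iff_integrableOn_abs_deriv_smul
    measurableSet_Ioi hderiv hinj] at hint
  rw [← image_two_mul_sinh_half, integral_image_eq_integral_abs_deriv_smul
    measurableSet_Ioi hderiv hinj] at hval
  calc _ = ∫ t in Set.Ioi (0 : ℝ), (2 : ℝ) ^ (-2 * α) * Real.exp (-z) *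
        (|Real.cosh (t / 2)| • ((2 * Real.sinh (t / 2)) ^ (2 * α - 1) *
          Real.exp (-(z / 2) * (2 * Real.sinh (t / 2)) ^ (2 : ℝ)))) := by
        rw [integral_const_mul, hval]; ring
    _ ≤ besselK α z := by
      refine setIntegral_mono_on (hint.const_mul _)
        (integrable_exp_neg_mul_cosh_mul_cosh hz α).integrableOn measurableSet_Ioi fun t ht => ?_
      rw [Set.mem_Ioi] at ht
      have hs : 0 < Real.sinh (t / 2) := Real.sinh_pos_iff.2 (half_pos ht)
      have hc : 0 < Real.cosh (t / 2) := Real.cosh_pos _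
      have hcosh : Real.cosh t = 1 + 2 * Real.sinh (t / 2) ^ 2 := by
        have := Real.cosh_two_mul (t / 2)
        rw [mul_div_cancel₀ _ two_ne_zero] at this
        rw [this, Real.cosh_sq]; ring
      have he : Real.exp (-z) * Real.exp (-(z / 2) * (2 * Real.sinh (t / 2)) ^ (2 : ℝ))
          = Real.exp (-z * Real.cosh t) := by
        rw [← Real.exp_add, hcosh, Real.rpow_two]; congr 1; ring
      have hle : Real.sinh (t / 2) ≤ Real.exp (t / 2) := by
        rw [Real.sinh_eq]; linarith [Real.exp_pos (t / 2), Real.exp_pos (-(t / 2))]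
      have hle' : Real.cosh (t / 2) ≤ Real.exp (t / 2) := by
        have : Real.exp (-(t / 2)) ≤ Real.exp (t / 2) := by gcongr; linarith
        rw [Real.cosh_eq]; linarith
      have hp : (2 : ℝ) ^ (-2 * α) * (2 * Real.sinh (t / 2)) ^ (2 * α - 1) =
          1 / 2 * Real.sinh (t / 2) ^ (2 * α - 1) := by
        rw [Real.mul_rpow two_pos.le hs.le, ← mul_assoc, ← Real.rpow_add two_pos,
          show -2 * α + (2 * α - 1) = -1 by ring, Real.rpow_neg_one, one_div]
      -- This is where `α ≥ 1 / 2` enters: the exponent `2 * α - 1` has to be nonnegative.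
      have hcα : Real.cosh (t / 2) * Real.sinh (t / 2) ^ (2 * α - 1) ≤ Real.exp (α * t) := by
        calc _ ≤ Real.exp (t / 2) * Real.exp (t / 2) ^ (2 * α - 1) := by
              gcongr; linarith
          _ = _ := by rw [← Real.exp_mul, ← Real.exp_add]; congr 1; ring
      have hch : Real.exp (α * t) / 2 ≤ Real.cosh (α * t) := by
        rw [Real.cosh_eq]; linarith [Real.exp_pos (-(α * t))]
      calc _ = Real.exp (-z * Real.cosh t) *
            (Real.cosh (t / 2) * Real.sinh (t / 2) ^ (2 * α - 1) / 2) := by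
            rw [abs_of_pos hc, smul_eq_mul, ← he]
            linear_combination (Real.exp (-z) * Real.cosh (t / 2) *
              Real.exp (-(z / 2) * (2 * Real.sinh (t / 2)) ^ (2 : ℝ))) * hp
        _ ≤ _ := by gcongr; linarith

/-! ### The Green kernel as a Laplace transform of the heat kernel -/

variable {n : ℕ} {μ ν : ℝ}

/-- The heat kernel of `∂ₜ - μ Δ + ν`, that is, the integral kernel of the semigroup
`exp (-t (-μ Δ + ν))`. Only `t > 0` is meaningful. -/
def dampedHeatKernel (n : ℕ) (μ ν t : ℝ) (x : EuclideanSpace ℝ (Fin n)) : ℝ :=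
  Real.exp (-ν * t) * (4 * Real.pi * μ * t) ^ (-(n : ℝ) / 2) * Real.exp (-(‖x‖ ^ 2 / (4 * μ * t)))

/-- The substitution `t = ‖x‖ / (2 √(νμ)) * exp s` turns the heat kernel into the integrand of the
Bessel function. -/
lemma greenKernel_eq_integral_dampedHeatKernel (hμ : 0 < μ) (hν : 0 < ν)
    {x : EuclideanSpace ℝ (Fin n)} (hx : x ≠ 0) :
    greenKernel n μ ν x = ∫ t in Set.Ioi 0, dampedHeatKernel n μ ν t x := by
  have hr : 0 < ‖x‖ := norm_pos_iff.2 hx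
  have hsμ : 0 < √μ := Real.sqrt_pos.2 hμ
  have hsν : 0 < √ν := Real.sqrt_pos.2 hν
  have hμ2 : √μ * √μ = μ := Real.mul_self_sqrt hμ.le
  have hν2 : √ν * √ν = ν := Real.mul_self_sqrt hν.le
  set q := √(ν * μ) / ‖x‖ with hq
  have hqs : q = √ν * √μ / ‖x‖ := by rw [hq, Real.sqrt_mul hν.le]
  have hq0 : 0 < q := by rw [hqs]; positivity
  have hsub : ∀ s : ℝ, 1 / (2 * q) * Real.exp s *
      dampedHeatKernel n μ ν (1 / (2 * q) * Real.exp s) x =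
      (2 * Real.pi * μ) ^ (-(n : ℝ) / 2) * q ^ ((n : ℝ) / 2 - 1) * (1 / 2) *
        (Real.exp (-(√ν * ‖x‖ / √μ) * Real.cosh s) * Real.exp (-((n : ℝ) / 2 - 1) * s)) := by
    intro s
    have e1 : (4 * Real.pi * μ * (1 / (2 * q) * Real.exp s)) ^ (-(n : ℝ) / 2)
        = (2 * Real.pi * μ) ^ (-(n : ℝ) / 2) * q ^ ((n : ℝ) / 2) * Real.exp (-(n : ℝ) / 2 * s) := by
      rw [show 4 * Real.pi * μ * (1 / (2 * q) * Real.exp s) = 2 * Real.pi * μ * q⁻¹ * Real.exp s by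
        field_simp; norm_num, Real.mul_rpow (by positivity) (by positivity),
        Real.mul_rpow (by positivity) (by positivity), ← Real.exp_mul, Real.inv_rpow hq0.le,
        ← Real.rpow_neg hq0.le]
      congr 2
      · ring_nf
      · ring
    have e2 : q ^ ((n : ℝ) / 2) = q * q ^ ((n : ℝ) / 2 - 1) := by
      rw [Real.rpow_sub_one hq0.ne']; field_simp
    have e3 : Real.exp (-ν * (1 / (2 * q) * Real.exp s)) *
        Real.exp (-(‖x‖ ^ 2 / (4 * μ * (1 / (2 * q) * Real.exp s))))
        = Real.exp (-(√ν * ‖x‖ / √μ) * Real.cosh s) := by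
      have k1 : -ν * (1 / (2 * q) * Real.exp s) = -(√ν * ‖x‖ / √μ) / 2 * Real.exp s := by
        rw [hqs]
        field_simp
        rw [sq, hν2]
      have k2 : ‖x‖ ^ 2 / (4 * μ * (1 / (2 * q) * Real.exp s)) =
          √ν * ‖x‖ / √μ / 2 * (Real.exp s)⁻¹ := by
        rw [hqs]
        field_simp
        linear_combination 4 * hμ2
      rw [← Real.exp_add, Real.cosh_eq, Real.exp_neg, k1, k2]
      congr 1
      ring
    have e4 : Real.exp s * Real.exp (-(n : ℝ) / 2 * s) = Real.exp (-((n : ℝ) / 2 - 1) * s) := by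
      rw [← Real.exp_add]; congr 1; ring
    rw [dampedHeatKernel, e1, e2, ← e3, ← e4]
    field_simp
  rw [integral_Ioi_eq_integral_const_mul_exp (by positivity : 0 < 1 / (2 * q)),
    integral_congr_ae (ae_of_all _ hsub), integral_const_mul, greenKernel,
    besselK_eq_integral_real (by positivity)]
  ring

lemma dampedHeatKernel_nonneg (hμ : 0 < μ) {t : ℝ} (ht : 0 < t) (x : EuclideanSpace ℝ (Fin n)) :
    0 ≤ dampedHeatKernel n μ ν t x := by
  unfold dampedHeatKernel; positivity

lemma measurable_dampedHeatKernel (n : ℕ) (μ ν : ℝ) :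
    Measurable fun p : ℝ × EuclideanSpace ℝ (Fin n) => dampedHeatKernel n μ ν p.1 p.2 := by
  unfold dampedHeatKernel; fun_prop

lemma dampedHeatKernel_eq (t : ℝ) (x : EuclideanSpace ℝ (Fin n)) :
    dampedHeatKernel n μ ν t x = Real.exp (-ν * t) * (4 * Real.pi * μ * t) ^ (-(n : ℝ) / 2) *
      Real.exp (-(1 / (4 * μ * t)) * ‖x‖ ^ 2) := by
  rw [dampedHeatKernel]; congr 2; ring

lemma integrable_dampedHeatKernel (hμ : 0 < μ) {t : ℝ} (ht : 0 < t) :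
    Integrable (dampedHeatKernel n μ ν t) := by
  have h := (GaussianFourier.integrable_cexp_neg_mul_sq_norm_add (V := EuclideanSpace ℝ (Fin n))
    (b := ((1 / (4 * μ * t) : ℝ) : ℂ)) (by rw [Complex.ofReal_re]; positivity) 0 0).norm
  have h' : Integrable fun x : EuclideanSpace ℝ (Fin n) =>
      Real.exp (-(1 / (4 * μ * t)) * ‖x‖ ^ 2) := by
    refine h.congr (ae_of_all _ fun x => ?_)
    simp [Complex.norm_exp, ← Complex.ofReal_pow]
  exact (h'.const_mul _).congr (ae_of_all _ fun x => (dampedHeatKernel_eq t x).symm)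

lemma integral_dampedHeatKernel (hμ : 0 < μ) {t : ℝ} (ht : 0 < t) :
    ∫ x, dampedHeatKernel n μ ν t x = Real.exp (-ν * t) := by
  have hb : 0 < 1 / (4 * μ * t) := by positivity
  simp_rw [dampedHeatKernel_eq]
  rw [integral_const_mul, GaussianFourier.integral_rexp_neg_mul_sq_norm hb, mul_assoc,
    finrank_euclideanSpace_fin, show Real.pi / (1 / (4 * μ * t)) = 4 * Real.pi * μ * t by
      field_simp, ← Real.rpow_add (by positivity)]
  ring_nf
  simp

lemma integrable_prod_dampedHeatKernel (n : ℕ) (hμ : 0 < μ) (hν : 0 < ν) :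
    Integrable (fun p : ℝ × EuclideanSpace ℝ (Fin n) => dampedHeatKernel n μ ν p.1 p.2)
      ((volume.restrict (Set.Ioi 0)).prod volume) := by
  refine (integrable_prod_iff (measurable_dampedHeatKernel n μ ν).aestronglyMeasurable).2
    ⟨?_, ?_⟩
  · exact (ae_restrict_mem measurableSet_Ioi).mono fun t ht => integrable_dampedHeatKernel hμ ht
  · have := exp_neg_integrableOn_Ioi 0 hν
    refine Integrable.congr this ?_
    refine (ae_restrict_mem measurableSet_Ioi).mono fun t ht => ?_
    simp only
    rw [← integral_dampedHeatKernel (n := n) hμ ht]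
    exact integral_congr_ae (ae_of_all _ fun x =>
      (Real.norm_of_nonneg (dampedHeatKernel_nonneg hμ ht x)).symm)

/-- The point `x = 0`, where `greenKernel` has a meaningless value, is a null set for `n ≠ 0`. -/
lemma greenKernel_ae_eq (hn : n ≠ 0) (hμ : 0 < μ) (hν : 0 < ν) :
    (fun x => ∫ t in Set.Ioi 0, dampedHeatKernel n μ ν t x) =ᵐ[volume] greenKernel n μ ν := by
  have : NeZero n := ⟨hn⟩
  filter_upwards [Measure.ae_ne volume (0 : EuclideanSpace ℝ (Fin n))] with x hx
  exact (greenKernel_eq_integral_dampedHeatKernel hμ hν hx).symm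

lemma integrable_greenKernel (hn : n ≠ 0) (hμ : 0 < μ) (hν : 0 < ν) :
    Integrable (greenKernel n μ ν) :=
  (integrable_prod_dampedHeatKernel n hμ hν).integral_prod_right.congr
    (greenKernel_ae_eq hn hμ hν)

/-! ### Fourier transform of the Green kernel -/

lemma fourier_dampedHeatKernel (hμ : 0 < μ) {t : ℝ} (ht : 0 < t) (ξ : EuclideanSpace ℝ (Fin n)) :
    𝓕 (fun x : EuclideanSpace ℝ (Fin n) => (dampedHeatKernel n μ ν t x : ℂ)) ξ =
      Real.exp (-((4 * Real.pi ^ 2 * μ * ‖ξ‖ ^ 2 + ν) * t)) := by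
  have hc : 0 < 4 * Real.pi * μ * t := by positivity
  have h := fourier_gaussian_innerProductSpace (V := EuclideanSpace ℝ (Fin n))
    (b := ((1 / (4 * μ * t) : ℝ) : ℂ)) (by rw [Complex.ofReal_re]; positivity) ξ
  have e : (fun x : EuclideanSpace ℝ (Fin n) => (dampedHeatKernel n μ ν t x : ℂ)) =
      ((Real.exp (-ν * t) * (4 * Real.pi * μ * t) ^ (-(n : ℝ) / 2) : ℝ) : ℂ) •
        fun x : EuclideanSpace ℝ (Fin n) =>
          Complex.exp (-((1 / (4 * μ * t) : ℝ) : ℂ) * (‖x‖ : ℂ) ^ 2) := by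
    ext x
    rw [dampedHeatKernel_eq]
    push_cast
    rfl
  have e1 : ((Real.pi : ℂ) / ((1 / (4 * μ * t) : ℝ) : ℂ)) ^
      ((Module.finrank ℝ (EuclideanSpace ℝ (Fin n)) : ℂ) / 2) =
      (((4 * Real.pi * μ * t) ^ ((n : ℝ) / 2) : ℝ) : ℂ) := by
    rw [Complex.ofReal_cpow hc.le, finrank_euclideanSpace_fin]
    push_cast
    congr 1
    field_simp
  have e2 : Complex.exp (-(Real.pi : ℂ) ^ 2 * (‖ξ‖ : ℂ) ^ 2 / ((1 / (4 * μ * t) : ℝ) : ℂ)) =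
      (Real.exp (-(4 * Real.pi ^ 2 * μ * ‖ξ‖ ^ 2 * t)) : ℂ) := by
    push_cast
    congr 1
    field_simp
  have hsmul : ∀ (c : ℂ) (f : EuclideanSpace ℝ (Fin n) → ℂ), 𝓕 (c • f) ξ = c • 𝓕 f ξ := by
    intro c f
    rw [Real.fourier_eq, Real.fourier_eq, ← integral_smul]
    exact integral_congr_ae (ae_of_all _ fun x => by
      simp only [Pi.smul_apply, Circle.smul_def, smul_eq_mul]; ring)
  rw [e, hsmul, h, e1, e2, smul_eq_mul]
  rw [← Complex.ofReal_mul, ← Complex.ofReal_mul, mul_assoc,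
    ← mul_assoc (_ ^ _) (_ ^ _), ← Real.rpow_add hc, neg_div, neg_add_cancel, Real.rpow_zero,
    one_mul, ← Real.exp_add]
  congr 2; ring

/-- Integrating the Fourier transform of the heat kernel in time gives the Fourier transform of the
Green kernel. -/
lemma fourier_greenKernel (hn : n ≠ 0) (hμ : 0 < μ) (hν : 0 < ν) (ξ : EuclideanSpace ℝ (Fin n)) :
    𝓕 (fun x : EuclideanSpace ℝ (Fin n) => (greenKernel n μ ν x : ℂ)) ξ =
      ((4 * Real.pi ^ 2 * μ * ‖ξ‖ ^ 2 + ν)⁻¹ : ℝ) := by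
  have hm : 0 < 4 * Real.pi ^ 2 * μ * ‖ξ‖ ^ 2 + ν := by positivity
  have hint : Integrable (Function.uncurry fun (t : ℝ) (x : EuclideanSpace ℝ (Fin n)) =>
      Real.fourierChar (-(inner ℝ x ξ)) • (dampedHeatKernel n μ ν t x : ℂ))
      ((volume.restrict (Set.Ioi 0)).prod volume) := by
    refine ((integrable_prod_dampedHeatKernel n hμ hν).ofReal (𝕜 := ℂ)).mono ?_
      (ae_of_all _ fun p => ?_)
    · refine AEStronglyMeasurable.smul (f := fun p : ℝ × EuclideanSpace ℝ (Fin n) =>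
        Real.fourierChar (-(inner ℝ p.2 ξ))) ?_ ?_
      · exact Continuous.aestronglyMeasurable (by fun_prop)
      · exact ((integrable_prod_dampedHeatKernel n hμ hν).ofReal (𝕜 := ℂ)).aestronglyMeasurable
    · simp [Function.uncurry, Circle.norm_smul]
  rw [Real.fourier_eq]
  calc _ = ∫ x, ∫ t in Set.Ioi 0,
        Real.fourierChar (-(inner ℝ x ξ)) • (dampedHeatKernel n μ ν t x : ℂ) := by
        refine integral_congr_ae ((greenKernel_ae_eq hn hμ hν).mono fun x hx => ?_)
        simp only at hx ⊢
        rw [← hx, ← integral_complex_ofReal]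
        simp_rw [Circle.smul_def]
        rw [integral_smul]
    _ = ∫ t in Set.Ioi 0, ∫ x,
        Real.fourierChar (-(inner ℝ x ξ)) • (dampedHeatKernel n μ ν t x : ℂ) :=
        (integral_integral_swap hint).symm
    _ = ∫ t in Set.Ioi 0, (Real.exp (-((4 * Real.pi ^ 2 * μ * ‖ξ‖ ^ 2 + ν) * t)) : ℂ) := by
        refine setIntegral_congr_fun measurableSet_Ioi fun t ht => ?_
        rw [← Real.fourier_eq, fourier_dampedHeatKernel hμ ht]
    _ = _ := by
        rw [integral_complex_ofReal]
        have := Real.integral_rpow_mul_exp_neg_mul_Ioi one_pos hm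
        simp only [sub_self, Real.rpow_zero, one_mul, Real.rpow_one, Real.Gamma_one,
          mul_one] at this
        rw [this, one_div]

/-! ### The operator `-μ Δ + ν` on Schwartz functions -/

/-- The symbol `4π²μ|ξ|² + ν` of `-μ Δ + ν`. -/
def helmholtzSymbol (n : ℕ) (μ ν : ℝ) (ξ : EuclideanSpace ℝ (Fin n)) : ℝ :=
  4 * Real.pi ^ 2 * μ * ‖ξ‖ ^ 2 + ν

lemma helmholtzSymbol_pos (hμ : 0 < μ) (hν : 0 < ν) (ξ : EuclideanSpace ℝ (Fin n)) :
    0 < helmholtzSymbol n μ ν ξ := by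
  unfold helmholtzSymbol; positivity

lemma hasTemperateGrowth_helmholtzSymbol (n : ℕ) (μ ν : ℝ) :
    (fun ξ => (helmholtzSymbol n μ ν ξ : ℂ)).HasTemperateGrowth := by
  unfold helmholtzSymbol; fun_prop

lemma hasTemperateGrowth_helmholtzSymbol_inv (n : ℕ) (hμ : 0 < μ) (hν : 0 < ν) :
    (fun ξ => ((helmholtzSymbol n μ ν ξ)⁻¹ : ℂ)).HasTemperateGrowth := by
  -- Up to the factor `ν`, the symbol is `1 + ‖c • ξ‖ ^ 2` with `c = √(4π²μ/ν)`.
  have h : (fun ξ : EuclideanSpace ℝ (Fin n) => ((helmholtzSymbol n μ ν ξ)⁻¹ : ℂ)) =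
      fun ξ => ((ν⁻¹ : ℝ) : ℂ) * (((fun y : EuclideanSpace ℝ (Fin n) =>
        (1 + ‖y‖ ^ 2) ^ (-1 : ℝ)) (√(4 * Real.pi ^ 2 * μ / ν) • ξ) : ℝ) : ℂ) := by
    ext ξ
    simp only
    rw [← Complex.ofReal_inv, ← Complex.ofReal_mul, helmholtzSymbol, norm_smul, mul_pow,
      Real.norm_of_nonneg (Real.sqrt_nonneg _), Real.sq_sqrt (by positivity), Real.rpow_neg_one,
      ← mul_inv]
    congr 2
    field_simp
    ring
  have h1 : (fun ξ : EuclideanSpace ℝ (Fin n) =>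
      (fun y : EuclideanSpace ℝ (Fin n) => (1 + ‖y‖ ^ 2) ^ (-1 : ℝ))
        (√(4 * Real.pi ^ 2 * μ / ν) • ξ)).HasTemperateGrowth :=
    (Function.hasTemperateGrowth_one_add_norm_sq_rpow _ (-1)).comp (by fun_prop)
  rw [h]
  fun_prop

/-- The operator `-μ Δ + ν` on Schwartz functions. -/
def schwartzHelmholtz (μ ν : ℝ) (φ : 𝓢(EuclideanSpace ℝ (Fin n), ℂ)) :
    𝓢(EuclideanSpace ℝ (Fin n), ℂ) :=
  -(μ : ℂ) • Δ φ + (ν : ℂ) • φ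

lemma schwartzHelmholtz_eq_fourierInv (φ : 𝓢(EuclideanSpace ℝ (Fin n), ℂ)) :
    schwartzHelmholtz μ ν φ =
      𝓕⁻ (SchwartzMap.smulLeftCLM ℂ (fun ξ => (helmholtzSymbol n μ ν ξ : ℂ)) (𝓕 φ)) := by
  have hφ : φ = 𝓕⁻ (𝓕 φ) := (fourierInv_fourier_eq φ).symm
  rw [schwartzHelmholtz, SchwartzMap.laplacian_eq_fourierMultiplierCLM,
    SchwartzMap.fourierMultiplierCLM_apply]
  nth_rewrite 2 [hφ]
  rw [← fourierInv_smul, ← fourierInv_smul, ← fourierInv_smul, ← fourierInv_add]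
  congr 1
  ext ξ
  have h1 : (fun ξ : EuclideanSpace ℝ (Fin n) => ‖ξ‖ ^ 2).HasTemperateGrowth := by fun_prop
  rw [SchwartzMap.smulLeftCLM_apply_apply (hasTemperateGrowth_helmholtzSymbol n μ ν)]
  change -(μ : ℂ) • (-(2 * Real.pi) ^ 2 • (SchwartzMap.smulLeftCLM ℂ
    (fun ξ : EuclideanSpace ℝ (Fin n) => ‖ξ‖ ^ 2) (𝓕 φ)) ξ) + (ν : ℂ) • (𝓕 φ) ξ = _
  rw [SchwartzMap.smulLeftCLM_apply_apply h1, helmholtzSymbol]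
  simp only [smul_eq_mul, Complex.real_smul]
  push_cast
  ring

lemma schwartzHelmholtz_surjective (n : ℕ) (hμ : 0 < μ) (hν : 0 < ν) :
    Function.Surjective (schwartzHelmholtz (n := n) μ ν) := by
  intro ψ
  refine ⟨𝓕⁻ (SchwartzMap.smulLeftCLM ℂ (fun ξ => ((helmholtzSymbol n μ ν ξ)⁻¹ : ℂ)) (𝓕 ψ) :
    𝓢(EuclideanSpace ℝ (Fin n), ℂ)), ?_⟩
  rw [schwartzHelmholtz_eq_fourierInv, fourier_fourierInv_eq]
  conv_rhs => rw [show ψ = 𝓕⁻ (𝓕 ψ : 𝓢(EuclideanSpace ℝ (Fin n), ℂ)) from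
    (fourierInv_fourier_eq ψ).symm]
  congr 1
  ext ξ
  rw [SchwartzMap.smulLeftCLM_apply_apply (hasTemperateGrowth_helmholtzSymbol n μ ν),
    SchwartzMap.smulLeftCLM_apply_apply (hasTemperateGrowth_helmholtzSymbol_inv n hμ hν),
    smul_eq_mul, smul_eq_mul, mul_inv_cancel_left₀]
  exact_mod_cast (helmholtzSymbol_pos hμ hν ξ).ne'

lemma greenKernel_sub_comm (x y : EuclideanSpace ℝ (Fin n)) :
    greenKernel n μ ν (x - y) = greenKernel n μ ν (y - x) := by
  rw [greenKernel, greenKernel, norm_sub_rev]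

/-- The Green kernel inverts `-μ Δ + ν` on Schwartz functions. On the Fourier side, the kernel
translated by `x` has transform `e^{-2πi⟨x, ξ⟩} / (4π²μ|ξ|² + ν)`, whose denominator cancels against
the symbol; Fourier inversion does the rest. -/
lemma integral_greenKernel_mul_schwartzHelmholtz (hn : n ≠ 0) (hμ : 0 < μ) (hν : 0 < ν)
    (φ : 𝓢(EuclideanSpace ℝ (Fin n), ℂ)) (x : EuclideanSpace ℝ (Fin n)) :
    ∫ ξ, (greenKernel n μ ν (x - ξ) : ℂ) * schwartzHelmholtz μ ν φ ξ = φ x := by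
  set h := SchwartzMap.smulLeftCLM ℂ (fun ξ => (helmholtzSymbol n μ ν ξ : ℂ)) (𝓕 φ) with hh
  set g : EuclideanSpace ℝ (Fin n) → ℂ := fun ξ => greenKernel n μ ν (x - ξ) with hg
  have hgint : Integrable g :=
    ((integrable_greenKernel hn hμ hν).comp_sub_left x).ofReal
  have hfg : ∀ w, 𝓕 g w = Real.fourierChar (-(inner ℝ x w)) •
      ((helmholtzSymbol n μ ν w : ℂ)⁻¹) := by
    intro w
    have e : g = (fun y : EuclideanSpace ℝ (Fin n) => (greenKernel n μ ν y : ℂ)) ∘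
        fun v => v + (-x) := by
      ext ξ
      simp only [hg, Function.comp_apply, ← sub_eq_add_neg]
      rw [greenKernel_sub_comm]
    have := congrFun (VectorFourier.fourierIntegral_comp_add_right Real.fourierChar volume
      (innerₗ (EuclideanSpace ℝ (Fin n)))
      (fun y : EuclideanSpace ℝ (Fin n) => (greenKernel n μ ν y : ℂ)) (-x)) w
    rw [← e] at this
    have h2 := fourier_greenKernel hn hμ hν w
    refine this.trans ?_
    rw [show VectorFourier.fourierIntegral Real.fourierChar volume
      (innerₗ (EuclideanSpace ℝ (Fin n)))
      (fun y : EuclideanSpace ℝ (Fin n) => (greenKernel n μ ν y : ℂ)) w = _ from h2]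
    simp [helmholtzSymbol]
  -- Self-adjointness is applied to `𝓕`, so `𝓕⁻ h` is written as the Fourier transform of the
  -- reflection of `h`.
  have hneg : Integrable fun w => h (-w) := h.integrable.comp_neg
  have key : ∫ w, 𝓕 g w • h (-w) = ∫ y, g y • 𝓕 (fun w => h (-w)) y := by
    have := VectorFourier.integral_fourierIntegral_smul_eq_flip (e := Real.fourierChar)
      (L := innerₗ (EuclideanSpace ℝ (Fin n))) Real.continuous_fourierChar continuous_inner hgint
      hneg
    rwa [flip_innerₗ] at this
  calc _ = ∫ y, g y • 𝓕 (fun w => h (-w)) y := by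
        refine integral_congr_ae (ae_of_all _ fun y => ?_)
        simp only [smul_eq_mul, hg]
        rw [schwartzHelmholtz_eq_fourierInv, SchwartzMap.fourierInv_coe,
          Real.fourierInv_eq_fourier_comp_neg]
    _ = ∫ w, 𝓕 g w • h (-w) := key.symm
    _ = ∫ w, Real.fourierChar (-(inner ℝ w x)) • (𝓕 φ) (-w) := by
        refine integral_congr_ae (ae_of_all _ fun w => ?_)
        have hw : helmholtzSymbol n μ ν (-w) = helmholtzSymbol n μ ν w := by
          simp [helmholtzSymbol]
        have := (helmholtzSymbol_pos hμ hν w).ne'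
        simp only
        rw [hfg, hh, SchwartzMap.smulLeftCLM_apply_apply (hasTemperateGrowth_helmholtzSymbol n μ ν),
          hw, real_inner_comm, smul_assoc, smul_eq_mul, smul_eq_mul, inv_mul_cancel_left₀]
        exact_mod_cast this
    _ = 𝓕⁻ (𝓕 φ) x := by
        rw [SchwartzMap.fourierInv_coe, Real.fourierInv_eq_fourier_comp_neg, Real.fourier_eq]
    _ = φ x := by rw [fourierInv_fourier_eq]

/-! ### Existence of the fundamental solution -/

/-- A real test function, as a complex Schwartz function. -/
def IsTestFunction.toSchwartz {φ : EuclideanSpace ℝ (Fin n) → ℝ} (hφ : IsTestFunction φ) :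
    𝓢(EuclideanSpace ℝ (Fin n), ℂ) :=
  HasCompactSupport.toSchwartzMap (f := Complex.ofRealCLM ∘ φ) (hφ.2.comp_left rfl)
    (Complex.ofRealCLM.contDiff.comp hφ.1)

lemma IsTestFunction.toSchwartz_apply {φ : EuclideanSpace ℝ (Fin n) → ℝ} (hφ : IsTestFunction φ)
    (x : EuclideanSpace ℝ (Fin n)) : hφ.toSchwartz x = φ x := rfl

lemma IsTestFunction.schwartzHelmholtz_toSchwartz_apply {φ : EuclideanSpace ℝ (Fin n) → ℝ}
    (hφ : IsTestFunction φ) (x : EuclideanSpace ℝ (Fin n)) :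
    schwartzHelmholtz μ ν hφ.toSchwartz x = ((-μ * (Δ φ) x + ν * φ x : ℝ) : ℂ) := by
  have h : (Δ hφ.toSchwartz) x = (((Δ φ) x : ℝ) : ℂ) := by
    rw [SchwartzMap.laplacian_apply]
    exact ContDiffAt.laplacian_CLM_comp_left (l := Complex.ofRealCLM)
      (hφ.1.contDiffAt.of_le (WithTop.coe_le_coe.2 le_top))
  change -(μ : ℂ) • (Δ hφ.toSchwartz) x + (ν : ℂ) • hφ.toSchwartz x = _
  rw [h, hφ.toSchwartz_apply]
  simp

lemma continuousOn_greenKernel (hμ : 0 < μ) (hν : 0 < ν) :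
    ContinuousOn (greenKernel n μ ν) {0}ᶜ := by
  have hnorm : ∀ x ∈ ({0}ᶜ : Set (EuclideanSpace ℝ (Fin n))), ‖x‖ ≠ 0 := fun x hx =>
    norm_ne_zero_iff.2 hx
  refine ContinuousOn.mul (ContinuousOn.mul continuousOn_const ?_) ?_
  · refine ContinuousOn.rpow_const (continuousOn_const.div continuousOn_id.norm hnorm)
      fun x hx => Or.inl ?_
    have := hnorm x hx
    positivity
  · refine (continuousOn_besselK _).comp (by fun_prop) fun x hx => ?_
    have := norm_pos_iff.2 hx
    rw [Set.mem_Ioi]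
    positivity

lemma integrable_greenKernel_mul (hn : n ≠ 0) (hμ : 0 < μ) (hν : 0 < ν)
    {f : EuclideanSpace ℝ (Fin n) → ℝ} (hf : IsTestFunction f) (x : EuclideanSpace ℝ (Fin n)) :
    Integrable fun ξ => greenKernel n μ ν (x - ξ) * f ξ := by
  obtain ⟨C, hC⟩ := hf.1.continuous.bounded_above_of_compact_support hf.2
  exact ((integrable_greenKernel hn hμ hν).comp_sub_left x).mul_bdd
    hf.1.continuous.aestronglyMeasurable (ae_of_all _ hC)

/-- `H²` solutions are unique: the difference of two solutions pairs to zero with the range of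
`-μ Δ + ν` on Schwartz functions, which is everything. -/
lemma IsH2Solution.ae_eq (hμ : 0 < μ) (hν : 0 < ν) {f v w : EuclideanSpace ℝ (Fin n) → ℝ}
    (hv : IsH2Solution μ ν f v) (hw : IsH2Solution μ ν f w) : v =ᵐ[volume] w := by
  obtain ⟨hv, -, hv'⟩ := hv
  obtain ⟨hw, -, hw'⟩ := hw
  have hT : ∀ (T : 𝓢'(EuclideanSpace ℝ (Fin n), ℂ)) (φ : 𝓢(EuclideanSpace ℝ (Fin n), ℂ)),
      (-(μ : ℂ) • Δ T + (ν : ℂ) • T) φ = T (schwartzHelmholtz μ ν φ) := by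
    intro T φ
    rw [schwartzHelmholtz, map_add, map_smul, map_smul,
      ← TemperedDistribution.laplacian_apply_apply]
    rfl
  have hvw : Lp.toTemperedDistributionCLM ℂ volume 2 (hv.toLp - hw.toLp) = 0 := by
    rw [map_sub, sub_eq_zero]
    ext ψ
    obtain ⟨φ, rfl⟩ := schwartzHelmholtz_surjective n hμ hν ψ
    have h := (hv' φ).trans (hw' φ).symm
    rwa [hT, hT] at h
  have hmem : hv.toLp - hw.toLp ∈
      (Lp.toTemperedDistributionCLM ℂ (volume : Measure (EuclideanSpace ℝ (Fin n))) 2).ker := hvw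
  rw [Lp.ker_toTemperedDistributionCLM_eq_bot, Submodule.mem_bot, sub_eq_zero,
    MemLp.toLp_eq_toLp_iff] at hmem
  exact hmem.mono fun x hx => Complex.ofReal_injective hx

/-- The potential of a test function is the Schwartz solution of the equation. -/
lemma isH2Solution_integral_greenKernel (hn : n ≠ 0) (hμ : 0 < μ) (hν : 0 < ν)
    {f : EuclideanSpace ℝ (Fin n) → ℝ} (hf : IsTestFunction f) :
    IsH2Solution μ ν f fun x => ∫ ξ, greenKernel n μ ν (x - ξ) * f ξ := by
  obtain ⟨u, hu⟩ := schwartzHelmholtz_surjective n hμ hν hf.toSchwartz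
  have hux : (fun x => ((∫ ξ, greenKernel n μ ν (x - ξ) * f ξ : ℝ) : ℂ)) = u := by
    ext x
    rw [← integral_greenKernel_mul_schwartzHelmholtz hn hμ hν u x, hu, ← integral_complex_ofReal]
    simp_rw [hf.toSchwartz_apply, Complex.ofReal_mul]
  unfold IsH2Solution
  simp only [hux]
  have e : ((u.memLp 2 volume).toLp : 𝓢'(EuclideanSpace ℝ (Fin n), ℂ)) =
      u.toTemperedDistributionCLM (EuclideanSpace ℝ (Fin n)) ℂ volume :=
    Lp.toTemperedDistribution_toLp_eq u
  refine ⟨u.memLp 2 volume, ?_, fun φ => ?_⟩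
  · rw [e]; exact u.memSobolev
  · rw [e, TemperedDistribution.laplacian_toTemperedDistributionCLM_eq, ← map_smul, ← map_smul,
      ← map_add]
    change SchwartzMap.toTemperedDistributionCLM _ ℂ volume (schwartzHelmholtz μ ν u) φ = _
    rw [hu]
    exact SchwartzMap.toTemperedDistributionCLM_apply_apply volume hf.toSchwartz φ

lemma isFundamentalSolution_greenKernel (hn : n ≠ 0) (hμ : 0 < μ) (hν : 0 < ν) :
    IsFundamentalSolution μ ν
      (fun x ξ : EuclideanSpace ℝ (Fin n) => greenKernel n μ ν (x - ξ)) where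
  continuousOn_left ξ := (continuousOn_greenKernel hμ hν).comp (by fun_prop)
    fun x hx => sub_ne_zero.2 hx
  continuousOn_right x := (continuousOn_greenKernel hμ hν).comp (by fun_prop)
    fun ξ hξ => sub_ne_zero.2 (Ne.symm hξ)
  distrib_eq_zero ξ φ hφ hξ := by
    have h := integral_greenKernel_mul_schwartzHelmholtz hn hμ hν hφ.toSchwartz ξ
    rw [hφ.toSchwartz_apply, image_eq_zero_of_notMem_tsupport hξ] at h
    simp_rw [hφ.schwartzHelmholtz_toSchwartz_apply, ← Complex.ofReal_mul] at h
    rw [integral_complex_ofReal, Complex.ofReal_inj] at h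
    rw [← h]
    exact integral_congr_ae (ae_of_all _ fun x => by simp only [greenKernel_sub_comm x ξ])
  integrable f hf x := integrable_greenKernel_mul hn hμ hν hf x
  isH2Solution f hf := isH2Solution_integral_greenKernel hn hμ hν hf
  unique_solution f hf v hv := hv.ae_eq hμ hν (isH2Solution_integral_greenKernel hn hμ hν hf)

/-! ### Uniqueness of the fundamental solution -/

/-- A countable family of smooth bumps: the centers, indexed by `i`, are dense, and the radii
`1 / (k + 1)` of the supports tend to zero. -/
def denseBump (n i k : ℕ) :
    ContDiffBump (TopologicalSpace.denseSeq (EuclideanSpace ℝ (Fin n)) i) where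
  rIn := 1 / (2 * (k + 1))
  rOut := 1 / (k + 1)
  rIn_pos := by positivity
  rIn_lt_rOut := by
    apply one_div_lt_one_div_of_lt
    · positivity
    · linarith [(Nat.cast_nonneg k : (0 : ℝ) ≤ k)]

lemma isTestFunction_denseBump (n i k : ℕ) : IsTestFunction (denseBump n i k) :=
  ⟨(denseBump n i k).contDiff, (denseBump n i k).hasCompactSupport⟩

/-- Continuous functions on an open set can be compared by testing against countably many bumps. -/
lemma nonpos_of_integral_mul_denseBump_eq_zero {D : EuclideanSpace ℝ (Fin n) → ℝ}
    {U : Set (EuclideanSpace ℝ (Fin n))} (hU : IsOpen U) (hD : ContinuousOn D U)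
    (hint : ∀ i k, Integrable fun ξ => D ξ * denseBump n i k ξ)
    (hzero : ∀ i k, ∫ ξ, D ξ * denseBump n i k ξ = 0) : ∀ ξ ∈ U, D ξ ≤ 0 := by
  intro ξ hξ
  by_contra! hpos
  have hV : IsOpen (U ∩ D ⁻¹' Set.Ioi 0) := hD.isOpen_inter_preimage hU isOpen_Ioi
  obtain ⟨ε, hε, hball⟩ := Metric.isOpen_iff.1 hV ξ ⟨hξ, hpos⟩
  obtain ⟨k, hk⟩ := exists_nat_one_div_lt (half_pos hε)
  obtain ⟨i, hi⟩ := Metric.denseRange_iff.1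
    (TopologicalSpace.denseRange_denseSeq (EuclideanSpace ℝ (Fin n))) ξ _ (half_pos hε)
  set b := denseBump n i k with hb
  have hDpos : ∀ y, b y ≠ 0 → 0 < D y := by
    intro y hy
    have hy' : y ∈ Function.support b := hy
    rw [b.support_eq] at hy'
    refine (hball ?_).2
    have h1 : dist y (TopologicalSpace.denseSeq (EuclideanSpace ℝ (Fin n)) i) < 1 / ((k : ℝ) + 1) :=
      hy'
    rw [Metric.mem_ball]
    linarith [dist_triangle_right y ξ (TopologicalSpace.denseSeq (EuclideanSpace ℝ (Fin n)) i)]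
  have hnn : 0 ≤ fun y => D y * b y := by
    intro y
    by_cases hy : b y = 0
    · simp [hy]
    · exact mul_nonneg (hDpos y hy).le b.nonneg
  have hae := (integral_eq_zero_iff_of_nonneg hnn (hint i k)).1 (hzero i k)
  have hnull : volume (Metric.ball (TopologicalSpace.denseSeq (EuclideanSpace ℝ (Fin n)) i) b.rOut)
      = 0 := by
    refine measure_mono_null (fun y hy => ?_) hae
    rw [← b.support_eq] at hy
    exact (mul_pos (hDpos y hy) (b.nonneg.lt_of_ne' hy)).ne'
  exact (Metric.measure_ball_pos volume _ b.rOut_pos).ne' hnull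

/-- Two fundamental solutions have almost everywhere the same potentials of countably many bumps,
hence agree off the diagonal for almost every `x`; continuity in `x` removes the null set. -/
lemma IsFundamentalSolution.eq (hμ : 0 < μ) (hν : 0 < ν)
    {G H : EuclideanSpace ℝ (Fin n) → EuclideanSpace ℝ (Fin n) → ℝ}
    (hG : IsFundamentalSolution μ ν G) (hH : IsFundamentalSolution μ ν H)
    {x ξ : EuclideanSpace ℝ (Fin n)} (hxξ : x ≠ ξ) : G x ξ = H x ξ := by
  have hle : ∀ {G H : EuclideanSpace ℝ (Fin n) → EuclideanSpace ℝ (Fin n) → ℝ},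
      IsFundamentalSolution μ ν G → IsFundamentalSolution μ ν H →
      ∀ᵐ x, ∀ ξ ≠ x, G x ξ ≤ H x ξ := by
    intro G H hG hH
    have h : ∀ᵐ x, ∀ i k, ∫ ξ, G x ξ * denseBump n i k ξ = ∫ ξ, H x ξ * denseBump n i k ξ :=
      ae_all_iff.2 fun i => ae_all_iff.2 fun k =>
        (hG.isH2Solution _ (isTestFunction_denseBump n i k)).ae_eq hμ hν
          (hH.isH2Solution _ (isTestFunction_denseBump n i k))
    filter_upwards [h] with x hx ξ hξ
    have hGi := fun i k => hG.integrable _ (isTestFunction_denseBump n i k) x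
    have hHi := fun i k => hH.integrable _ (isTestFunction_denseBump n i k) x
    refine sub_nonpos.1 (nonpos_of_integral_mul_denseBump_eq_zero (D := fun ξ => G x ξ - H x ξ)
      (isOpen_compl_singleton (x := x))
      ((hG.continuousOn_right x).sub (hH.continuousOn_right x)) ?_ ?_ ξ hξ)
    · intro i k
      simp_rw [sub_mul]
      exact (hGi i k).sub (hHi i k)
    · intro i k
      simp_rw [sub_mul]
      rw [integral_sub (hGi i k) (hHi i k), hx, sub_self]
  have hdense : Dense {x | ∀ ξ ≠ x, G x ξ = H x ξ} := by
    refine Measure.dense_of_ae (μ := volume) ?_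
    filter_upwards [hle hG hH, hle hH hG] with x h1 h2 ξ hξ
    exact le_antisymm (h1 ξ hξ) (h2 ξ hξ)
  by_contra hne
  have hopen : IsOpen ({ξ}ᶜ ∩ (fun x => G x ξ - H x ξ) ⁻¹' {0}ᶜ) :=
    ((hG.continuousOn_left ξ).sub (hH.continuousOn_left ξ)).isOpen_inter_preimage
      isOpen_compl_singleton isOpen_compl_singleton
  obtain ⟨y, ⟨hyξ, hy⟩, hy'⟩ := hdense.inter_open_nonempty _ hopen ⟨x, hxξ, sub_ne_zero.2 hne⟩
  exact hy (sub_eq_zero.2 (hy' ξ (Ne.symm hyξ)))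

/-! ### Two-sided bound for the Green kernel -/

/-- The bounds `c z ^ (-α) exp (-z) ≤ K_α(z) ≤ C z ^ (-α) exp (-z / 2)`, with `α = n / 2 - 1` and
`z = √ν |x| / √μ`, become bounds by multiples of `|x| ^ (-2α) = |x| ^ (2 - n)`. -/
lemma exists_bound_greenKernel (hn : 3 ≤ n) (hμ : 0 < μ) (hν : 0 < ν) :
    ∃ C : ℝ, 1 < C ∧ ∀ x : EuclideanSpace ℝ (Fin n), x ≠ 0 →
      C⁻¹ * (Real.exp (-(√ν * ‖x‖ / √μ)) / ‖x‖ ^ (n - 2)) ≤ greenKernel n μ ν x ∧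
      greenKernel n μ ν x ≤ C * (Real.exp (-(√ν * ‖x‖ / (2 * √μ))) / ‖x‖ ^ (n - 2)) := by
  have hsμ : 0 < √μ := Real.sqrt_pos.2 hμ
  have hsν : 0 < √ν := Real.sqrt_pos.2 hν
  have hsνμ : 0 < √(ν * μ) := Real.sqrt_pos.2 (mul_pos hν hμ)
  have hn' : (3 : ℝ) ≤ n := by exact_mod_cast hn
  set α : ℝ := (n : ℝ) / 2 - 1 with hα
  have hα2 : 1 / 2 ≤ α := by rw [hα]; linarith
  have hα0 : 0 < α := by linarith
  have hΓ := Real.Gamma_pos_of_pos hα0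
  set A : ℝ := (2 * Real.pi * μ) ^ (-(n : ℝ) / 2) with hA
  have hA0 : 0 < A := by positivity
  set c₁ := A * ((2 : ℝ) ^ (-2 * α) * (1 / 2) * Real.Gamma α) *
    (√(ν * μ) * (2 / (√ν / √μ))) ^ α with hc₁
  set c₂ := A * Real.Gamma α * (√(ν * μ) * (4 / (√ν / √μ))) ^ α with hc₂
  have hc₁0 : 0 < c₁ := by positivity
  have hc₂0 : 0 < c₂ := by positivity
  refine ⟨1 + c₁⁻¹ + c₂, by linarith [inv_pos.2 hc₁0], fun x hx => ?_⟩
  have hr : 0 < ‖x‖ := norm_pos_iff.2 hx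
  have hz : 0 < √ν * ‖x‖ / √μ := by positivity
  have hpow : ∀ a : ℝ, 0 < a → (√(ν * μ) / ‖x‖) ^ α * (a / (√ν * ‖x‖ / √μ)) ^ α =
      (√(ν * μ) * (a / (√ν / √μ))) ^ α / ‖x‖ ^ (n - 2) := by
    intro a ha
    have e : ‖x‖ ^ (n - 2) = (‖x‖ * ‖x‖) ^ α := by
      rw [← sq, ← Real.rpow_natCast, ← Real.rpow_natCast, ← Real.rpow_mul hr.le,
        Nat.cast_sub (by omega), hα]
      congr 1
      push_cast
      ring
    rw [e, ← Real.mul_rpow (by positivity) (by positivity),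
      ← Real.div_rpow (by positivity) (by positivity)]
    congr 1
    field_simp
  have hC₁ : (1 + c₁⁻¹ + c₂)⁻¹ ≤ c₁ := by
    rw [inv_le_comm₀ (by positivity) hc₁0]
    linarith
  have hC₂ : c₂ ≤ 1 + c₁⁻¹ + c₂ := by linarith [inv_pos.2 hc₁0]
  constructor
  · calc _ ≤ c₁ * (Real.exp (-(√ν * ‖x‖ / √μ)) / ‖x‖ ^ (n - 2)) := by gcongr
      _ = A * (√(ν * μ) / ‖x‖) ^ α * ((2 : ℝ) ^ (-2 * α) * (1 / 2) * Real.Gamma α *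
          (2 / (√ν * ‖x‖ / √μ)) ^ α * Real.exp (-(√ν * ‖x‖ / √μ))) := by
          rw [hc₁]
          linear_combination -(A * ((2 : ℝ) ^ (-2 * α) * (1 / 2) * Real.Gamma α) *
            Real.exp (-(√ν * ‖x‖ / √μ))) * hpow 2 two_pos
      _ ≤ greenKernel n μ ν x := by
          rw [greenKernel]
          gcongr
          exact le_besselK hα2 hz
  · calc greenKernel n μ ν x ≤ A * (√(ν * μ) / ‖x‖) ^ α * (Real.Gamma α *
          (4 / (√ν * ‖x‖ / √μ)) ^ α * Real.exp (-(√ν * ‖x‖ / √μ / 2))) := by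
          rw [greenKernel]
          gcongr
          exact besselK_le hα0 hz
      _ = c₂ * (Real.exp (-(√ν * ‖x‖ / (2 * √μ))) / ‖x‖ ^ (n - 2)) := by
          rw [hc₂, show √ν * ‖x‖ / √μ / 2 = √ν * ‖x‖ / (2 * √μ) by field_simp]
          linear_combination A * Real.Gamma α *
            Real.exp (-(√ν * ‖x‖ / (2 * √μ))) * hpow 4 four_pos
      _ ≤ _ := by gcongr

end

theorem lemma2p2 (n : ℕ) (hn : 3 ≤ n) (μ ν : ℝ) (hμ : 0 < μ) (hν : 0 < ν) :
    IsFundamentalSolution μ ν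
      (fun x ξ : EuclideanSpace ℝ (Fin n) => greenKernel n μ ν (x - ξ)) ∧
    (∀ G : EuclideanSpace ℝ (Fin n) → EuclideanSpace ℝ (Fin n) → ℝ,
      IsFundamentalSolution μ ν G → ∀ x ξ, x ≠ ξ → G x ξ = greenKernel n μ ν (x - ξ)) ∧
    ∃ C : ℝ, 1 < C ∧ ∀ x : EuclideanSpace ℝ (Fin n), x ≠ 0 →
      C⁻¹ * (Real.exp (-(Real.sqrt ν * ‖x‖ / Real.sqrt μ)) / ‖x‖ ^ (n - 2))
        ≤ greenKernel n μ ν x ∧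
      greenKernel n μ ν x
        ≤ C * (Real.exp (-(Real.sqrt ν * ‖x‖ / (2 * Real.sqrt μ))) / ‖x‖ ^ (n - 2)) := by
  have h := isFundamentalSolution_greenKernel (n := n) (by omega) hμ hν
  exact ⟨h, fun G hG x ξ hxξ => hG.eq hμ hν h hxξ, exists_bound_greenKernel hn hμ hν⟩
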